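/- Corollary. For $n\ge 1$ let $B_n$ be the braid group on $n$ strands with standard generators $\sigma_1,\dots,\sigma_{n-1}$ (each a positive crossing), let $w(\beta)$ be the exponent sum of $\beta\in B_n$, let $\widehat\beta$ be the closure of $\beta$, an oriented link, and let $\Delta=(\sigma_1\cdots\sigma_{n-1})(\sigma_1\cdots\sigma_{n-2})\cdots\sigma_1$ be the Garside half twist, so that $\Delta^{-2}$ is the negative full twist. Let $H_D(v,z)$ be the framed Homfly polynomial of an oriented link diagram $D$: the integer Laurent polynomial, invariant under regular isotopy, that satisfies $H_{D_+}-H_{D_-}=zH_{D_0}$ for every Conway triple, equals $1$ on the crossingless diagram of the unknot, and is multiplied by $v^{-1}$ (respectively $v$) when a positive (respectively negative) curl is added. Let $P_{\widehat\beta}(v,z)=v^{w(\beta)}H_{\widehat\beta}(v,z)$ be the Homfly polynomial of the closure of $\beta$. The left (right) column of $P$ is the coefficient, a Laurent polynomial in $z$, of the lowest (highest) power of $v$ that occurs in $P$. For $\beta\in B_n$, the lower MFW estimate is $w(\beta)-n+1\le(\text{lowest }v\text{-degree of }P_{\widehat\beta})$ and the upper MFW estimate is $(\text{highest }v\text{-degree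 of }P_{\widehat\beta})\le w(\beta)+n-1$; an estimate is sharp for $\beta$ if it is an equality. For every braid $\beta$ on $n\ge1$ strands, the upper MFW estimate is sharp for $\beta$ if and only if the lower MFW estimate is sharp for $\beta\Delta^{-2}$. If this is the case, then the right column of $P_{\widehat\beta}$ equals $(-1)^{n-1}$ times the left column of $P_{\widehat{\beta\Delta^{-2}}}$. -/

import Mathlib

open scoped LaurentPolynomial

namespace Homfly

/-! ### Braid groups -/

/-- The indices of the generators of the braid group on `n` strands. The generator with
index `i` crosses the strands in positions `i` and `i + 1`, positions being `0, …, n - 1`. -/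
abbrev Gen (n : ℕ) : Type := {i : ℕ // i + 1 < n}

/-- Artin's relations: far commutativity and the braid relation. -/
def artinRels (n : ℕ) : Set (FreeGroup (Gen n)) :=
  {r | ∃ i j : Gen n, i.1 + 2 ≤ j.1 ∧
    r = FreeGroup.of i * FreeGroup.of j * (FreeGroup.of j * FreeGroup.of i)⁻¹} ∪
  {r | ∃ i j : Gen n, j.1 = i.1 + 1 ∧
    r = FreeGroup.of i * FreeGroup.of j * FreeGroup.of i *
      (FreeGroup.of j * FreeGroup.of i * FreeGroup.of j)⁻¹}

/-- The braid group on `n` strands. -/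
abbrev Braid (n : ℕ) : Type := PresentedGroup (artinRels n)

/-- The standard generator: a single positive crossing of strands `i` and `i + 1`. -/
def σ {n : ℕ} (i : Gen n) : Braid n := PresentedGroup.of i

/-- A homomorphism out of the braid group, from images of the generators that satisfy
Artin's relations. -/
def Braid.lift {n : ℕ} {G : Type*} [Group G] (f : Gen n → G)
    (hc : ∀ i j : Gen n, i.1 + 2 ≤ j.1 → f i * f j = f j * f i)
    (hb : ∀ i j : Gen n, j.1 = i.1 + 1 → f i * f j * f i = f j * f i * f j) : Braid n →* G :=
  PresentedGroup.toGroup (f := f) (by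
    rintro r (⟨i, j, h, rfl⟩ | ⟨i, j, h, rfl⟩)
    · simp only [map_mul, map_inv, FreeGroup.lift_apply_of]
      rw [hc i j h, mul_inv_cancel]
    · simp only [map_mul, map_inv, FreeGroup.lift_apply_of]
      rw [hb i j h, mul_inv_cancel])

theorem Braid.lift_σ {n : ℕ} {G : Type*} [Group G] (f : Gen n → G)
    (hc : ∀ i j : Gen n, i.1 + 2 ≤ j.1 → f i * f j = f j * f i)
    (hb : ∀ i j : Gen n, j.1 = i.1 + 1 → f i * f j * f i = f j * f i * f j) (i : Gen n) :
    Braid.lift f hc hb (σ i) = f i :=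
  PresentedGroup.toGroup.of _

theorem σ_comm {n : ℕ} (i j : Gen n) (h : i.1 + 2 ≤ j.1) : σ i * σ j = σ j * σ i := by
  refine mul_inv_eq_one.mp (PresentedGroup.one_of_mem (rels := artinRels n) ?_)
  exact Or.inl ⟨i, j, h, rfl⟩

theorem σ_braid {n : ℕ} (i j : Gen n) (h : j.1 = i.1 + 1) :
    σ i * σ j * σ i = σ j * σ i * σ j := by
  refine mul_inv_eq_one.mp (PresentedGroup.one_of_mem (rels := artinRels n) ?_)
  exact Or.inr ⟨i, j, h, rfl⟩

/-- Adding a trivial strand after the last one. -/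
def addStrand (n : ℕ) : Braid n →* Braid (n + 1) :=
  Braid.lift (fun i => σ ⟨i.1, Nat.lt_succ_of_lt i.2⟩)
    (fun _ _ h => σ_comm _ _ h) (fun _ _ h => σ_braid _ _ h)

/-- The exponent sum of a braid, which is the writhe of its closure. -/
def expSum {n : ℕ} (β : Braid n) : ℤ :=
  Multiplicative.toAdd
    (Braid.lift (fun _ : Gen n => Multiplicative.ofAdd (1 : ℤ))
      (fun _ _ _ => rfl) (fun _ _ _ => rfl) β)

/-- The Garside half twist: in the usual notation
`(σ₁ σ₂ ⋯ σₙ₋₁) (σ₁ ⋯ σₙ₋₂) ⋯ (σ₁ σ₂) σ₁`. -/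
def Δ : (n : ℕ) → Braid n
  | 0 => 1
  | n + 1 => (List.ofFn fun i : Fin n => σ ⟨i.1, Nat.succ_lt_succ i.2⟩).prod * addStrand n (Δ n)

/-! ### The framed Homfly polynomial of closed braids -/

/-- Integer Laurent polynomials in `v` and `z`, written as Laurent polynomials in `v`
whose coefficients are Laurent polynomials in `z`. -/
abbrev LaurentVZ : Type := ℤ[T;T⁻¹][T;T⁻¹]

/-- The monomial `v ^ k`. -/
noncomputable def vPow (k : ℤ) : LaurentVZ := LaurentPolynomial.T k

/-- The indeterminate `z`. -/
noncomputable def z : LaurentVZ := LaurentPolynomial.C (LaurentPolynomial.T 1)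

/-- The crossing generator that joins the last strand to the one before it. -/
def lastGen (n : ℕ) : Gen (n + 2) := ⟨n, Nat.lt_succ_self _⟩

/-- The defining relations of the framed Homfly polynomial `H` on the diagrams of closed
braids; `H n β` is the value on the closure of `β`, a braid on `n` strands. Invariance under
regular isotopy inside the braid is built into the use of elements of the braid group.

Every clause but the last is an instance of a relation that the framed Homfly polynomial of
oriented link diagrams satisfies. Since these clauses have exactly one solution
(`existsUnique_framedHomfly`), that solution is the restriction of the framed Homfly
polynomial to closed braids. -/
structure IsFramedHomfly (H : (n : ℕ) → Braid n → LaurentVZ) : Prop where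
  /-- Conjugate braids have regularly isotopic closures. -/
  conj : ∀ (n : ℕ) (α β : Braid n), H n (α * β) = H n (β * α)
  /-- The Conway skein relation, at any crossing of a closed braid. -/
  skein : ∀ (n : ℕ) (α β : Braid n) (i : Gen n),
    H n (α * σ i * β) - H n (α * (σ i)⁻¹ * β) = z * H n (α * β)
  /-- Removing a positive curl (a positive Markov destabilization). -/
  curl_pos : ∀ (n : ℕ) (α : Braid (n + 1)),
    H (n + 2) (addStrand (n + 1) α * σ (lastGen n)) = vPow (-1) * H (n + 1) α
  /-- Removing a negative curl (a negative Markov destabilization). -/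
  curl_neg : ∀ (n : ℕ) (α : Braid (n + 1)),
    H (n + 2) (addStrand (n + 1) α * (σ (lastGen n))⁻¹) = vPow 1 * H (n + 1) α
  /-- The crossingless diagram of the unknot. -/
  unknot : H 1 1 = 1
  /-- A convention for the empty diagram, for which the polynomial is not defined. -/
  empty : ∀ β : Braid 0, H 0 β = 0

/-! ### Uniqueness -/

/-- The braids whose skein-theoretic invariants are determined by those of the braids in `X`:
in a Conway triple, the braid with the positive (or negative) crossing is reached from
the two others. -/
inductive SkeinSpan {n : ℕ} (X : Set (Braid n)) : Braid n → Prop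
  | base (g : Braid n) : g ∈ X → SkeinSpan X g
  | pos (x y : Braid n) (i : Gen n) : SkeinSpan X (x * (σ i)⁻¹ * y) → SkeinSpan X (x * y) → SkeinSpan X (x * σ i * y)
  | neg (x y : Braid n) (i : Gen n) : SkeinSpan X (x * σ i * y) → SkeinSpan X (x * y) → SkeinSpan X (x * (σ i)⁻¹ * y)

/-- Braids on `n + 1` strands in which the last generator occurs at most once. -/
def Basic (n : ℕ) : Set (Braid (n + 1)) :=
  {g | (∃ a, g = addStrand n a) ∨
    ∃ (h : 0 < n) (a b : Braid n),
      g = addStrand n a * σ ⟨n - 1, by omega⟩ * addStrand n b}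

theorem addStrand_σ {n : ℕ} (i : Gen n) :
    addStrand n (σ i) = σ ⟨i.1, Nat.lt_succ_of_lt i.2⟩ := Braid.lift_σ _ _ _ i

theorem Braid.ind {n : ℕ} {p : Braid n → Prop} (one : p 1) (pos : ∀ i g, p g → p (σ i * g))
    (neg : ∀ i g, p g → p ((σ i)⁻¹ * g)) (g : Braid n) : p g := by
  have h : g ∈ Subgroup.closure (Set.range (σ (n := n))) := by
    have := PresentedGroup.closure_range_of (artinRels n)
    change g ∈ Subgroup.closure (Set.range PresentedGroup.of)
    rw [this]; trivial
  induction h using Subgroup.closure_induction_left with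
  | one => exact one
  | mul_left x hx y hy ih => obtain ⟨i, rfl⟩ := hx; exact pos i _ ih
  | inv_mul_cancel x hx y hy ih => obtain ⟨i, rfl⟩ := hx; exact neg i _ ih

theorem last_comm {n : ℕ} (a : Braid n) :
    σ (lastGen n) * addStrand (n + 1) (addStrand n a) =
      addStrand (n + 1) (addStrand n a) * σ (lastGen n) := by
  induction a using Braid.ind with
  | one => simp
  | pos i g ih =>
    have := σ_comm (⟨i.1, by have := i.2; omega⟩ : Gen (n + 2)) (lastGen n)
      (by have := i.2; simp only [lastGen]; omega)
    simp only [map_mul, addStrand_σ]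
    rw [← mul_assoc, ← this, mul_assoc, ih, mul_assoc]
  | neg i g ih =>
    have := σ_comm (⟨i.1, by have := i.2; omega⟩ : Gen (n + 2)) (lastGen n)
      (by have := i.2; simp only [lastGen]; omega)
    simp only [map_mul, map_inv, addStrand_σ]
    have h2 : σ (lastGen n) * (σ (⟨i.1, by have := i.2; omega⟩ : Gen (n + 2)))⁻¹ =
        (σ (⟨i.1, by have := i.2; omega⟩ : Gen (n + 2)))⁻¹ * σ (lastGen n) := by
      rw [mul_inv_eq_iff_eq_mul, mul_assoc, ← this]; group
    rw [← mul_assoc, h2, mul_assoc, ih, mul_assoc]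

theorem basic_base {n : ℕ} (a : Braid n) : SkeinSpan (Basic n) (addStrand n a) :=
  .base _ (Or.inl ⟨a, rfl⟩)

theorem basic_last {n : ℕ} (a b : Braid (n + 1)) :
    SkeinSpan (Basic (n + 1)) (addStrand (n + 1) a * σ (lastGen n) * addStrand (n + 1) b) :=
  .base _ (Or.inr ⟨Nat.succ_pos _, a, b, rfl⟩)

theorem SkeinSpan.map {n m : ℕ} {X : Set (Braid n)} {Y : Set (Braid m)}
    (F : Braid n → Braid m) (hX : ∀ g ∈ X, SkeinSpan Y (F g))
    (hF : ∀ x i y, ∃ x' i' y', F (x * σ i * y) = x' * σ i' * y' ∧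
      F (x * (σ i)⁻¹ * y) = x' * (σ i')⁻¹ * y' ∧ F (x * y) = x' * y')
    {g : Braid n} (h : SkeinSpan X g) : SkeinSpan Y (F g) := by
  induction h with
  | base g hg => exact hX g hg
  | pos x y i _ _ h1 h2 =>
    obtain ⟨x', i', y', e1, e2, e3⟩ := hF x i y
    rw [e1]; rw [e2] at h1; rw [e3] at h2; exact .pos _ _ _ h1 h2
  | neg x y i _ _ h1 h2 =>
    obtain ⟨x', i', y', e1, e2, e3⟩ := hF x i y
    rw [e2]; rw [e1] at h1; rw [e3] at h2; exact .neg _ _ _ h1 h2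

theorem cl_basic : ∀ (n : ℕ) (g : Braid (n + 1)), SkeinSpan (Basic n) g := by
  intro n
  induction n with
  | zero =>
    intro g
    induction g using Braid.ind with
    | one => simpa using basic_base (1 : Braid 0)
    | pos i => exact absurd i.2 (by omega)
    | neg i => exact absurd i.2 (by omega)
  | succ n IH =>
    -- the braids in which the last generator occurs twice, with one of them in front
    have key : ∀ a b : Braid (n + 1), SkeinSpan (Basic (n + 1))
        (σ (lastGen n) * addStrand (n + 1) a * σ (lastGen n) * addStrand (n + 1) b) := by
      intro a b
      refine SkeinSpan.map (fun a => σ (lastGen n) * addStrand (n + 1) a *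
        σ (lastGen n) * addStrand (n + 1) b) ?_ ?_ (IH a)
      · rintro g (⟨a', rfl⟩ | ⟨h, a', b', rfl⟩)
        · rw [last_comm, mul_assoc, mul_assoc, ← mul_assoc (σ _), ← mul_assoc]
          rw [← mul_assoc]
          refine .pos _ _ _ ?_ ?_
          · rw [mul_inv_cancel_right, ← map_mul]; exact basic_base _
          · exact basic_last _ _
        · obtain ⟨m, rfl⟩ : ∃ m, n = m + 1 := ⟨n - 1, by omega⟩
          have hb := σ_braid (⟨m, by omega⟩ : Gen (m + 1 + 2)) (lastGen (m + 1)) rfl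
          have e : σ (lastGen (m + 1)) * addStrand (m + 1 + 1) (addStrand (m + 1) a' *
              σ ⟨m + 1 - 1, by omega⟩ * addStrand (m + 1) b') * σ (lastGen (m + 1)) *
              addStrand (m + 1 + 1) b =
              addStrand (m + 1 + 1) (addStrand (m + 1) a' * σ ⟨m, by omega⟩) *
              σ (lastGen (m + 1)) *
              addStrand (m + 1 + 1) (σ ⟨m, by omega⟩ * addStrand (m + 1) b' * b) := by
            simp only [map_mul, addStrand_σ, Nat.add_sub_cancel]
            calc _ = (σ (lastGen (m + 1)) * addStrand _ (addStrand (m + 1) a')) *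
                  σ ⟨m, by omega⟩ * (addStrand _ (addStrand _ b') * σ (lastGen (m + 1))) *
                  addStrand _ b := by simp only [mul_assoc]
              _ = addStrand _ (addStrand (m + 1) a') *
                  (σ (lastGen (m + 1)) * σ ⟨m, by omega⟩ * σ (lastGen (m + 1))) *
                  addStrand _ (addStrand _ b') * addStrand _ b := by
                rw [last_comm a', ← last_comm b']; simp only [mul_assoc]
              _ = _ := by rw [← hb]; simp only [mul_assoc]
          rw [e]
          exact basic_last _ _
      · intro x i y
        refine ⟨σ (lastGen n) * addStrand (n + 1) x, ⟨i.1, by have := i.2; omega⟩,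
          addStrand (n + 1) y * σ (lastGen n) * addStrand (n + 1) b, ?_, ?_, ?_⟩ <;>
        simp only [map_mul, map_inv, addStrand_σ, mul_assoc]
    have gen : ∀ (i : Gen (n + 2)) (g : Braid (n + 2)), g ∈ Basic (n + 1) →
        SkeinSpan (Basic (n + 1)) (σ i * g) := by
      intro i g hg
      by_cases hi : i.1 = n
      · obtain rfl : i = lastGen n := Subtype.ext hi
        rcases hg with ⟨a, rfl⟩ | ⟨h, a, b, rfl⟩
        · simpa using basic_last 1 a
        · have hk := key a b
          simp only [mul_assoc] at hk ⊢
          exact hk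
      · have e : σ i = addStrand (n + 1) (σ ⟨i.1, by have := i.2; omega⟩) :=
          (addStrand_σ (n := n + 1) ⟨i.1, by have := i.2; omega⟩).symm
        rw [e]
        rcases hg with ⟨a, rfl⟩ | ⟨h, a, b, rfl⟩
        · rw [← map_mul]; exact basic_base _
        · rw [← mul_assoc, ← mul_assoc, ← map_mul]; exact basic_last _ _
    have gen' : ∀ (i : Gen (n + 2)) (g : Braid (n + 2)), SkeinSpan (Basic (n + 1)) g →
        SkeinSpan (Basic (n + 1)) (σ i * g) := fun i g hg =>
      SkeinSpan.map (fun g => σ i * g) (gen i)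
        (fun x j y => ⟨σ i * x, j, y, by simp only [mul_assoc], by simp only [mul_assoc],
          by simp only [mul_assoc]⟩) hg
    intro g
    induction g using Braid.ind with
    | one => simpa using basic_base (1 : Braid (n + 1))
    | pos i g ih => exact gen' i g ih
    | neg i g ih =>
      have := SkeinSpan.neg (X := Basic (n + 1)) 1 g i (by simpa using gen' i g ih) (by simpa using ih)
      simpa using this

theorem z_mul_cancel {a b : LaurentVZ} (h : z * a = z * b) : a = b := by
  have hz : IsUnit z := (LaurentPolynomial.isUnit_T 1).map LaurentPolynomial.C
  exact hz.mul_left_cancel h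

theorem Braid.one_of_le {n : ℕ} (hn : n ≤ 1) (β : Braid n) : β = 1 := by
  induction β using Braid.ind with
  | one => rfl
  | pos i => exact absurd i.2 (by omega)
  | neg i => exact absurd i.2 (by omega)

theorem IsFramedHomfly.unique {H H' : (n : ℕ) → Braid n → LaurentVZ}
    (h : IsFramedHomfly H) (h' : IsFramedHomfly H') : H = H' := by
  have key : ∀ (n : ℕ) (β : Braid (n + 1)), H (n + 1) β = H' (n + 1) β := by
    intro n
    induction n with
    | zero =>
      intro β
      rw [Braid.one_of_le (by omega) β, h.unknot, h'.unknot]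
    | succ n IH =>
      intro β
      induction cl_basic (n + 1) β with
      | base g hg =>
        rcases hg with ⟨a, rfl⟩ | ⟨_, a, b, rfl⟩
        · have e := h.skein _ (addStrand (n + 1) a) 1 (lastGen n)
          have e' := h'.skein _ (addStrand (n + 1) a) 1 (lastGen n)
          simp only [mul_one, h.curl_pos, h.curl_neg] at e
          simp only [mul_one, h'.curl_pos, h'.curl_neg] at e'
          rw [IH a, e'] at e
          exact (z_mul_cancel e).symm
        · rw [h.conj, h'.conj, ← mul_assoc, ← map_mul]
          exact (h.curl_pos n _).trans ((congrArg _ (IH _)).trans (h'.curl_pos n _).symm)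
      | pos x y i _ _ h1 h2 =>
        rw [sub_eq_iff_eq_add.mp (h.skein _ x y i), sub_eq_iff_eq_add.mp (h'.skein _ x y i), h1, h2]
      | neg x y i _ _ h1 h2 =>
        have e := h.skein _ x y i
        have e' := h'.skein _ x y i
        rw [h1, h2, ← e'] at e
        exact sub_right_injective e
  funext n β
  cases n with
  | zero => rw [h.empty, h'.empty]
  | succ n => exact key n β

/-! ### Existence

For a natural number `N ≥ 1` and a real number `q > 1` the braid group acts on real functions
on `Fin n → Fin N`, and a weighted trace of this action satisfies the defining relations
at `z = q - q⁻¹` and `v = q ^ (-N)`. -/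

section Existence

variable (N : ℕ) (q : ℝ)

/-- Diagonal entries of the action of a crossing. -/
noncomputable def wt (a b : Fin N) : ℝ := if a = b then q else if b < a then q - q⁻¹ else 0

/-- Off-diagonal entries of the action of a crossing. -/
noncomputable def sw (a b : Fin N) : ℝ := if a = b then 0 else 1

/-- The space on which the braid group on `n` strands acts. -/
abbrev Sp (n : ℕ) : Type := (Fin n → Fin N) → ℝ

/-- The action of a crossing of the strands in positions `i` and `j`. -/
noncomputable def op {n : ℕ} (i j : Fin n) : Module.End ℝ (Sp N n) where
  toFun f x := wt N q (x i) (x j) * f x + sw N (x i) (x j) * f (x ∘ Equiv.swap i j)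
  map_add' f g := by funext x; simp only [Pi.add_apply]; ring
  map_smul' c f := by funext x; simp only [Pi.smul_apply, smul_eq_mul, RingHom.id_apply]; ring

theorem op_apply {n : ℕ} (i j : Fin n) (f : Sp N n) (x : Fin n → Fin N) :
    op N q i j f x = wt N q (x i) (x j) * f x + sw N (x i) (x j) * f (x ∘ Equiv.swap i j) := rfl

theorem comp_swap_swap {n : ℕ} (i j : Fin n) (x : Fin n → Fin N) :
    (x ∘ Equiv.swap i j) ∘ Equiv.swap i j = x := by
  funext k; simp

theorem op_sq {q : ℝ} (hq : 1 < q) {n : ℕ} (i j : Fin n) :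
    op N q i j * op N q i j = (q - q⁻¹) • op N q i j + 1 := by
  have h0 : q ≠ 0 := by positivity
  apply LinearMap.ext; intro f; funext x
  simp only [Module.End.mul_apply, op_apply, LinearMap.add_apply, LinearMap.smul_apply,
    Pi.add_apply, Pi.smul_apply, Module.End.one_apply, comp_swap_swap, smul_eq_mul,
    Function.comp_apply, Equiv.swap_apply_left, Equiv.swap_apply_right]
  rcases lt_trichotomy (x i) (x j) with h | h | h
  · simp [wt, sw, h.ne, h.ne', h, h.not_gt]
  · simp [wt, sw, h]; field_simp; ring
  · simp [wt, sw, h.ne, h.ne', h, h.not_gt]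

theorem op_comm {n : ℕ} (i j k l : Fin n) (hik : i ≠ k) (hil : i ≠ l) (hjk : j ≠ k)
    (hjl : j ≠ l) : op N q i j * op N q k l = op N q k l * op N q i j := by
  apply LinearMap.ext; intro f; funext x
  have e : (x ∘ Equiv.swap i j) ∘ Equiv.swap k l = (x ∘ Equiv.swap k l) ∘ Equiv.swap i j := by
    have h : Equiv.swap i j * Equiv.swap k l = Equiv.swap k l * Equiv.swap i j := by
      apply Equiv.Perm.Disjoint.commute
      intro t
      by_cases h1 : t = i
      · subst h1; right; exact Equiv.swap_apply_of_ne_of_ne hik hil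
      · by_cases h2 : t = j
        · subst h2; right; exact Equiv.swap_apply_of_ne_of_ne hjk hjl
        · left; exact Equiv.swap_apply_of_ne_of_ne h1 h2
    funext t
    have := congrArg (fun p : Equiv.Perm (Fin n) => x (p t)) h
    simpa using this
  simp only [Module.End.mul_apply, op_apply, Function.comp_apply,
    Equiv.swap_apply_of_ne_of_ne hik hil, Equiv.swap_apply_of_ne_of_ne hjk hjl,
    Equiv.swap_apply_of_ne_of_ne hik.symm hjk.symm,
    Equiv.swap_apply_of_ne_of_ne hil.symm hjl.symm, e]
  ring

theorem op_braid {q : ℝ} (hq : 1 < q) {n : ℕ} (i j k : Fin n) (hij : i ≠ j) (hik : i ≠ k)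
    (hjk : j ≠ k) :
    op N q i j * op N q j k * op N q i j = op N q j k * op N q i j * op N q j k := by
  have h0 : q ≠ 0 := by positivity
  apply LinearMap.ext; intro f; funext x
  have e : ((x ∘ Equiv.swap i j) ∘ Equiv.swap j k) ∘ Equiv.swap i j =
      ((x ∘ Equiv.swap j k) ∘ Equiv.swap i j) ∘ Equiv.swap j k := by
    have h : Equiv.swap i j * Equiv.swap j k * Equiv.swap i j =
        Equiv.swap j k * Equiv.swap i j * Equiv.swap j k := by
      have h1 := Equiv.swap_mul_swap_mul_swap hij hik
      have h2 := Equiv.swap_mul_swap_mul_swap hjk.symm hik.symm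
      rw [h1, Equiv.swap_comm k i, ← h2, Equiv.swap_comm i j, Equiv.swap_comm j k]
    funext t
    have := congrArg (fun p : Equiv.Perm (Fin n) => x (p t)) h
    simpa using this
  simp only [Module.End.mul_apply, op_apply, Function.comp_apply, comp_swap_swap,
    Equiv.swap_apply_left, Equiv.swap_apply_right,
    Equiv.swap_apply_of_ne_of_ne hik.symm hjk.symm, Equiv.swap_apply_of_ne_of_ne hij hik, e]
  generalize f x = f0, f (x ∘ Equiv.swap i j) = f1, f (x ∘ Equiv.swap j k) = f2,
    f ((x ∘ Equiv.swap i j) ∘ Equiv.swap j k) = f3,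
    f ((x ∘ Equiv.swap j k) ∘ Equiv.swap i j) = f4,
    f (((x ∘ Equiv.swap j k) ∘ Equiv.swap i j) ∘ Equiv.swap j k) = f5, x i = a, x j = b, x k = c
  rcases lt_trichotomy a b with h | h | h <;>
  rcases lt_trichotomy b c with h' | h' | h' <;>
  rcases lt_trichotomy a c with h'' | h'' | h'' <;>
  first
  | (exfalso; omega)
  | (simp (disch := omega) only [wt, sw, if_pos, if_neg]; first | ring1 | (field_simp; ring1))

/-- The action of a crossing, as an invertible operator. -/
noncomputable def opUnit {q : ℝ} (hq : 1 < q) {n : ℕ} (i j : Fin n) : (Module.End ℝ (Sp N n))ˣ where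
  val := op N q i j
  inv := op N q i j - (q - q⁻¹) • 1
  val_inv := by rw [mul_sub, op_sq N hq, mul_smul_comm, mul_one]; abel
  inv_val := by rw [sub_mul, op_sq N hq, smul_mul_assoc, one_mul]; abel

/-- The action of the braid group. -/
noncomputable def rho {q : ℝ} (hq : 1 < q) (n : ℕ) : Braid n →* (Module.End ℝ (Sp N n))ˣ :=
  Braid.lift (fun i => opUnit N hq ⟨i.1, by have := i.2; omega⟩ ⟨i.1 + 1, i.2⟩)
    (fun i j h => Units.ext (op_comm N q _ _ _ _ (by simp; omega) (by simp; omega)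
      (by simp; omega) (by simp; omega)))
    (fun i j h => Units.ext (by
      have e : (⟨j.1, by have := j.2; omega⟩ : Fin n) = ⟨i.1 + 1, i.2⟩ := Fin.ext h
      have := op_braid N hq (⟨i.1, by have := i.2; omega⟩ : Fin n) ⟨i.1 + 1, i.2⟩ ⟨j.1 + 1, j.2⟩
        (by simp) (by simp; omega) (by simp; omega)
      simp only [Units.val_mul, opUnit, e]
      exact this))

theorem rho_σ {q : ℝ} (hq : 1 < q) {n : ℕ} (i : Gen n) :
    rho N hq n (σ i) = opUnit N hq ⟨i.1, by have := i.2; omega⟩ ⟨i.1 + 1, i.2⟩ :=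
  Braid.lift_σ _ _ _ i

theorem rho_σ_inv {q : ℝ} (hq : 1 < q) {n : ℕ} (i : Gen n) :
    ((rho N hq n (σ i)⁻¹ : (Module.End ℝ (Sp N n))ˣ) : Module.End ℝ (Sp N n)) =
      (rho N hq n (σ i) : Module.End ℝ (Sp N n)) - (q - q⁻¹) • 1 := by
  rw [map_inv, rho_σ]; rfl

/-- The weight of a color. -/
noncomputable def kap (a : Fin N) : ℝ := q ^ ((N : ℤ) - 1 - 2 * (a.1 : ℤ))

/-- Multiplication by the weight of a coloring. -/
noncomputable def wgt (n : ℕ) : Module.End ℝ (Sp N n) where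
  toFun f x := (∏ i, kap N q (x i)) * f x
  map_add' f g := by funext x; simp only [Pi.add_apply]; ring
  map_smul' c f := by funext x; simp only [Pi.smul_apply, smul_eq_mul, RingHom.id_apply]; ring

theorem wgt_apply {n : ℕ} (f : Sp N n) (x : Fin n → Fin N) :
    wgt N q n f x = (∏ i, kap N q (x i)) * f x := rfl

theorem wgt_comm_op {n : ℕ} (i j : Fin n) : Commute (wgt N q n) (op N q i j) := by
  apply LinearMap.ext; intro f; funext x
  have e : ∏ k, kap N q (x (Equiv.swap i j k)) = ∏ k, kap N q (x k) :=
    Equiv.prod_comp (Equiv.swap i j) (fun k => kap N q (x k))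
  simp only [Module.End.mul_apply, op_apply, wgt_apply, Function.comp_apply, e]
  ring

theorem wgt_comm {q : ℝ} (hq : 1 < q) {n : ℕ} (β : Braid n) :
    Commute (wgt N q n) (rho N hq n β : Module.End ℝ (Sp N n)) := by
  induction β using Braid.ind with
  | one => rw [map_one]; exact Commute.one_right _
  | pos i g ih =>
    rw [map_mul, Units.val_mul, rho_σ]
    exact (wgt_comm_op N q _ _).mul_right ih
  | neg i g ih =>
    rw [map_mul, Units.val_mul, rho_σ_inv, rho_σ]
    exact ((wgt_comm_op N q _ _).sub_right ((Commute.one_right _).smul_right _)).mul_right ih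

/-- The weighted trace of an operator. -/
noncomputable def wtr (n : ℕ) (A : Module.End ℝ (Sp N n)) : ℝ :=
  ∑ x : Fin n → Fin N, (∏ i, kap N q (x i)) * A (Pi.single x 1) x

theorem wtr_eq {n : ℕ} (A : Module.End ℝ (Sp N n)) :
    wtr N q n A = LinearMap.trace ℝ _ (wgt N q n * A) := by
  rw [LinearMap.trace_eq_matrix_trace ℝ (Pi.basisFun ℝ (Fin n → Fin N)), Matrix.trace]
  refine Finset.sum_congr rfl fun x _ => ?_
  simp [wgt_apply]

theorem wtr_conj {q : ℝ} (hq : 1 < q) {n : ℕ} (α β : Braid n) :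
    wtr N q n (rho N hq n (α * β) : Module.End ℝ (Sp N n)) =
      wtr N q n (rho N hq n (β * α) : Module.End ℝ (Sp N n)) := by
  simp only [wtr_eq, map_mul, Units.val_mul]
  rw [← mul_assoc, LinearMap.trace_mul_comm, ← mul_assoc, ← (wgt_comm N hq β).eq, mul_assoc]

theorem rho_addStrand {q : ℝ} (hq : 1 < q) {n : ℕ} (α : Braid n) :
    ∀ (f : Sp N (n + 1)) (y : Fin n → Fin N) (a : Fin N),
      (rho N hq (n + 1) (addStrand n α) : Module.End ℝ (Sp N (n + 1))) f (Fin.snoc y a) =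
        (rho N hq n α : Module.End ℝ (Sp N n)) (fun y' => f (Fin.snoc y' a)) y := by
  have key : ∀ (i : Gen n) (f : Sp N (n + 1)) (y : Fin n → Fin N) (a : Fin N),
      (rho N hq (n + 1) (addStrand n (σ i)) : Module.End ℝ (Sp N (n + 1))) f (Fin.snoc y a) =
        (rho N hq n (σ i) : Module.End ℝ (Sp N n)) (fun y' => f (Fin.snoc y' a)) y := by
    intro i f y a
    rw [addStrand_σ, rho_σ, rho_σ]
    have hi := i.2
    set p : Fin n := ⟨i.1, by omega⟩ with hp
    set r : Fin n := ⟨i.1 + 1, i.2⟩ with hr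
    change op N q p.castSucc r.castSucc f _ = op N q p r _ _
    have e : (Fin.snoc y a : Fin (n + 1) → Fin N) ∘ Equiv.swap p.castSucc r.castSucc =
        Fin.snoc (y ∘ Equiv.swap p r) a := by
      funext k
      refine Fin.lastCases ?_ (fun k => ?_) k
      · rw [Function.comp_apply, Equiv.swap_apply_of_ne_of_ne (Fin.castSucc_lt_last _).ne'
          (Fin.castSucc_lt_last _).ne']
        simp
      · rw [Function.comp_apply, ← (Fin.castSucc_injective n).map_swap]
        simp
    simp only [op_apply, Fin.snoc_castSucc, e]
  have key' : ∀ (i : Gen n) (f : Sp N (n + 1)) (y : Fin n → Fin N) (a : Fin N),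
      (rho N hq (n + 1) (addStrand n (σ i)⁻¹) : Module.End ℝ (Sp N (n + 1))) f (Fin.snoc y a) =
        (rho N hq n (σ i)⁻¹ : Module.End ℝ (Sp N n)) (fun y' => f (Fin.snoc y' a)) y := by
    intro i f y a
    have h := key i f y a
    rw [addStrand_σ] at h
    rw [map_inv (addStrand n), addStrand_σ, rho_σ_inv, rho_σ_inv]
    simp only [LinearMap.sub_apply, LinearMap.smul_apply, Module.End.one_apply, Pi.sub_apply,
      Pi.smul_apply, h]
  induction α using Braid.ind with
  | one => intro f y a; simp
  | pos i g ih =>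
    intro f y a
    simp only [map_mul, Units.val_mul, Module.End.mul_apply]
    rw [key]
    exact congrFun (congrArg _ (funext fun y' => ih f y' a)) y
  | neg i g ih =>
    intro f y a
    rw [map_mul (addStrand n), map_mul, map_mul, Units.val_mul, Units.val_mul,
      Module.End.mul_apply, Module.End.mul_apply, key']
    exact congrFun (congrArg _ (funext fun y' => ih f y' a)) y

theorem sum_snoc {n : ℕ} (F : (Fin (n + 1) → Fin N) → ℝ) :
    ∑ x, F x = ∑ y : Fin n → Fin N, ∑ a : Fin N, F (Fin.snoc y a) := by
  rw [← (Fin.snocEquiv (fun _ : Fin (n + 1) => Fin N)).sum_comp, Fintype.sum_prod_type,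
    Finset.sum_comm]
  rfl

theorem single_snoc {n : ℕ} (y y' : Fin n → Fin N) (a a' : Fin N) :
    (Pi.single (Fin.snoc y a : Fin (n + 1) → Fin N) (1 : ℝ) : Sp N (n + 1)) (Fin.snoc y' a') =
      if a' = a then (Pi.single y (1 : ℝ) : Sp N n) y' else 0 := by
  simp only [Pi.single_apply, Fin.snoc_inj]
  split_ifs <;> simp_all

theorem wtr_addStrand {q : ℝ} (hq : 1 < q) {n : ℕ} (α : Braid n) :
    wtr N q (n + 1) (rho N hq (n + 1) (addStrand n α) : Module.End ℝ (Sp N (n + 1))) =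
      (∑ a, kap N q a) * wtr N q n (rho N hq n α : Module.End ℝ (Sp N n)) := by
  rw [wtr, wtr, sum_snoc, Finset.mul_sum]
  refine Finset.sum_congr rfl fun y _ => ?_
  rw [Finset.sum_mul]
  refine Finset.sum_congr rfl fun a _ => ?_
  rw [rho_addStrand, Fin.prod_univ_castSucc]
  simp only [single_snoc, if_true, Fin.snoc_castSucc, Fin.snoc_last]
  ring

theorem sum_kap_wt {q : ℝ} (hq : 1 < q) (u : Fin N) :
    ∑ a, kap N q a * wt N q u a = q ^ N := by
  have h0 : q ≠ 0 := by positivity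
  have h1 : ∀ m : ℕ, ∀ h : m < N,
      ∑ a ∈ Finset.univ.filter (fun a : Fin N => a.1 < m), kap N q a * (q - q⁻¹) =
        q ^ N - q ^ ((N : ℤ) - 2 * m) := by
    intro m hm
    induction m with
    | zero => simp
    | succ m ih =>
      have e : Finset.univ.filter (fun a : Fin N => a.1 < m + 1) =
          insert ⟨m, by omega⟩ (Finset.univ.filter (fun a : Fin N => a.1 < m)) := by
        ext a; simp [Fin.ext_iff]; omega
      rw [e, Finset.sum_insert (by simp), ih (by omega), kap]
      have e1 : (N : ℤ) - 1 - 2 * ((m : ℕ) : ℤ) = ((N : ℤ) - 2 * m) - 1 := by ring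
      have e2 : (N : ℤ) - 2 * ((m + 1 : ℕ) : ℤ) = ((N : ℤ) - 2 * m) - 2 := by push_cast; ring
      simp only [e1, e2]
      rw [zpow_sub₀ h0, zpow_sub₀ h0 _ 2]
      field_simp
      ring
  have h2 : ∀ a : Fin N, kap N q a * wt N q u a =
      (if a.1 < u.1 then kap N q a * (q - q⁻¹) else 0) + if a = u then kap N q u * q else 0 := by
    intro a
    rcases lt_trichotomy a u with h | h | h
    · simp [wt, h, h.ne, h.ne']
    · simp [wt, h]
    · simp [wt, h.ne, h.ne', h.not_gt]
  simp only [h2, Finset.sum_add_distrib, Finset.sum_ite_eq', Finset.mem_univ, if_true]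
  rw [← Finset.sum_filter, h1 u.1 u.2, kap]
  have e1 : (N : ℤ) - 2 * ((u.1 : ℕ) : ℤ) = ((N : ℤ) - 1 - 2 * u.1) + 1 := by ring
  rw [e1, zpow_add₀ h0, zpow_one]
  ring

theorem sum_kap {q : ℝ} (hq : 1 < q) : (∑ a, kap N q a) * (q - q⁻¹) = q ^ N - (q ^ N)⁻¹ := by
  have h0 : q ≠ 0 := by positivity
  cases N with
  | zero => simp
  | succ M =>
    have := sum_kap_wt (M + 1) hq (Fin.last M)
    rw [Finset.sum_mul]
    have h2 : ∀ a : Fin (M + 1), kap (M + 1) q a * wt (M + 1) q (Fin.last M) a =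
        kap (M + 1) q a * (q - q⁻¹) + if a = Fin.last M then (q ^ (M + 1))⁻¹ else 0 := by
      intro a
      rcases (Fin.le_last a).lt_or_eq with h | h
      · simp [wt, h, h.ne, h.ne']
      · subst h
        have e1 : ((M + 1 : ℕ) : ℤ) - 1 - 2 * ((Fin.last M : Fin (M + 1)).1 : ℤ) = -(M : ℤ) := by
          simp; ring
        simp only [wt, if_true, kap, e1, zpow_neg, zpow_natCast]
        field_simp
        ring
    simp only [h2, Finset.sum_add_distrib, Finset.sum_ite_eq', Finset.mem_univ, if_true] at this
    linarith

theorem wtr_pos {q : ℝ} (hq : 1 < q) {n : ℕ} (α : Braid (n + 1)) :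
    wtr N q (n + 2) (rho N hq (n + 2) (addStrand (n + 1) α * σ (lastGen n)) :
      Module.End ℝ (Sp N (n + 2))) =
      q ^ N * wtr N q (n + 1) (rho N hq (n + 1) α : Module.End ℝ (Sp N (n + 1))) := by
  have hop : ∀ (y y' : Fin (n + 1) → Fin N) (a : Fin N),
      (rho N hq (n + 2) (σ (lastGen n)) : Module.End ℝ (Sp N (n + 2)))
        (Pi.single (Fin.snoc y a) 1) (Fin.snoc y' a) =
      wt N q (y (Fin.last n)) a * (Pi.single y (1 : ℝ) : Sp N (n + 1)) y' := by
    intro y y' a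
    rw [rho_σ]
    change op N q (Fin.last n).castSucc (Fin.last (n + 1)) _ _ = _
    rw [op_apply, single_snoc, if_pos rfl, Fin.snoc_castSucc, Fin.snoc_last]
    have h2 : sw N (y' (Fin.last n)) a * (Pi.single (Fin.snoc y a : Fin (n + 2) → Fin N) (1 : ℝ) :
        Sp N (n + 2)) ((Fin.snoc y' a : Fin (n + 2) → Fin N) ∘
          Equiv.swap (Fin.last n).castSucc (Fin.last (n + 1))) = 0 := by
      by_cases h : y' (Fin.last n) = a
      · simp [sw, h]
      · rw [Pi.single_apply, if_neg, mul_zero]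
        intro e
        have := congrFun e (Fin.last (n + 1))
        simp at this
        exact h this
    rw [h2, add_zero]
    by_cases h : y' = y
    · rw [h]
    · simp [h]
  rw [wtr, wtr, sum_snoc, Finset.mul_sum]
  refine Finset.sum_congr rfl fun y _ => ?_
  rw [← sum_kap_wt N hq (y (Fin.last n)), Finset.sum_mul]
  refine Finset.sum_congr rfl fun a _ => ?_
  rw [map_mul, Units.val_mul, Module.End.mul_apply, rho_addStrand, Fin.prod_univ_castSucc]
  simp only [hop, Fin.snoc_castSucc, Fin.snoc_last]
  have : (fun y' => wt N q (y (Fin.last n)) a * (Pi.single y (1 : ℝ) : Sp N (n + 1)) y') =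
      wt N q (y (Fin.last n)) a • (Pi.single y (1 : ℝ) : Sp N (n + 1)) := rfl
  rw [this, map_smul, Pi.smul_apply, smul_eq_mul]
  ring

theorem wtr_sub {n : ℕ} (A B : Module.End ℝ (Sp N n)) :
    wtr N q n (A - B) = wtr N q n A - wtr N q n B := by
  simp only [wtr_eq, mul_sub, map_sub]

theorem wtr_smul {n : ℕ} (c : ℝ) (A : Module.End ℝ (Sp N n)) :
    wtr N q n (c • A) = c * wtr N q n A := by
  simp only [wtr_eq, mul_smul_comm, map_smul, smul_eq_mul]

theorem wtr_skein {q : ℝ} (hq : 1 < q) {n : ℕ} (α β : Braid n) (i : Gen n) :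
    wtr N q n (rho N hq n (α * σ i * β) : Module.End ℝ (Sp N n)) -
      wtr N q n (rho N hq n (α * (σ i)⁻¹ * β) : Module.End ℝ (Sp N n)) =
      (q - q⁻¹) * wtr N q n (rho N hq n (α * β) : Module.End ℝ (Sp N n)) := by
  rw [← wtr_sub, ← wtr_smul]
  congr 1
  simp only [map_mul, Units.val_mul, rho_σ_inv, mul_sub, sub_mul, sub_sub_cancel, mul_smul_comm,
    smul_mul_assoc, mul_one]

theorem wtr_neg {q : ℝ} (hq : 1 < q) {n : ℕ} (α : Braid (n + 1)) :
    wtr N q (n + 2) (rho N hq (n + 2) (addStrand (n + 1) α * (σ (lastGen n))⁻¹) :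
      Module.End ℝ (Sp N (n + 2))) =
      (q ^ N)⁻¹ * wtr N q (n + 1) (rho N hq (n + 1) α : Module.End ℝ (Sp N (n + 1))) := by
  have h := wtr_skein N hq (addStrand (n + 1) α) 1 (lastGen n)
  rw [mul_one, mul_one, mul_one, wtr_pos, wtr_addStrand, ← mul_assoc, mul_comm (q - q⁻¹),
    sum_kap N hq] at h
  linear_combination -h

/-- The evaluation at `z = q - q⁻¹` and `v = q ^ (-N)`. -/
noncomputable def ev {q : ℝ} (hq : 1 < q) : LaurentVZ →+* ℝ :=
  LaurentPolynomial.eval₂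
    (LaurentPolynomial.eval₂ (Int.castRingHom ℝ)
      (Units.mk0 (q - q⁻¹) (sub_pos.mpr ((inv_lt_one_of_one_lt₀ hq).trans hq)).ne'))
    (Units.mk0 (q ^ N)⁻¹ (by positivity))

theorem ev_z {q : ℝ} (hq : 1 < q) : ev N hq z = q - q⁻¹ := by
  rw [ev, z, LaurentPolynomial.eval₂_C, LaurentPolynomial.eval₂_T]; simp

theorem ev_vPow {q : ℝ} (hq : 1 < q) : ev N hq (vPow 1) = (q ^ N)⁻¹ := by
  rw [ev, vPow, LaurentPolynomial.eval₂_T]; simp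

theorem ev_vPow_neg {q : ℝ} (hq : 1 < q) : ev N hq (vPow (-1)) = q ^ N := by
  rw [ev, vPow, LaurentPolynomial.eval₂_T]; simp

theorem coeff_eq_zero_of_eval {R : Type*} [CommRing R] (f : R →+* ℝ) (p : R[T;T⁻¹]) (s : Set ℝˣ)
    (hs : s.Infinite) (h : ∀ x ∈ s, LaurentPolynomial.eval₂ f x p = 0) (k : ℤ) :
    f (p.coeff k) = 0 := by
  obtain ⟨n, p', hp⟩ := p.exists_T_pow
  have h0 : p'.map f = 0 := by
    refine Polynomial.eq_zero_of_infinite_isRoot _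
      ((hs.image Units.val_injective.injOn).mono ?_)
    rintro _ ⟨x, hx, rfl⟩
    have := congrArg (LaurentPolynomial.eval₂ f x) hp
    rw [LaurentPolynomial.eval₂_toLaurent, map_mul, h x hx, zero_mul] at this
    rw [Set.mem_ofPred_eq, Polynomial.IsRoot.def, Polynomial.eval_map, this]
  have hc : ∀ j : ℤ, f ((Polynomial.toLaurent p').coeff j) = 0 := by
    intro j
    rw [LaurentPolynomial.coeff_toLaurent]
    by_cases hj : j ∈ Set.range (Nat.castEmbedding : ℕ ↪ ℤ)
    · obtain ⟨m, rfl⟩ := hj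
      rw [Finsupp.mapDomain_apply (Nat.castEmbedding : ℕ ↪ ℤ).injective]
      have := congrArg (fun r => r.coeff m) h0
      simp only [Polynomial.coeff_map, Polynomial.coeff_zero] at this
      exact this
    · rw [Finsupp.mapDomain_of_notMem_range _ _ hj, map_zero]
  have h1 := hc (k + n)
  rw [hp, LaurentPolynomial.T, AddMonoidAlgebra.coeff_mul_single_eq_coeff_mul k
    (fun m _ => add_left_inj _), mul_one] at h1
  exact h1

theorem eq_of_ev {p p' : LaurentVZ}
    (h : ∀ (N : ℕ) (q : ℝ) (hq : 1 < q), 1 ≤ N → ev N hq p = ev N hq p') : p = p' := by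
  rw [← sub_eq_zero]
  apply LaurentPolynomial.ext
  intro k
  apply LaurentPolynomial.ext
  intro l
  have hq1 : ∀ q : Set.Ioi (1 : ℝ), q.1 - q.1⁻¹ ≠ 0 := fun q =>
    (sub_pos.mpr ((inv_lt_one_of_one_lt₀ q.2).trans q.2)).ne'
  have key : Int.castRingHom ℝ (((p - p').coeff k).coeff l) = 0 := by
    refine coeff_eq_zero_of_eval _ _ (Set.range fun q : Set.Ioi (1 : ℝ) => Units.mk0 _ (hq1 q))
      ?_ ?_ l
    · have : Infinite (Set.Ioi (1 : ℝ)) := (Set.Ioi_infinite (1 : ℝ)).to_subtype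
      refine Set.infinite_range_of_injective ?_
      have hlt : ∀ a b : Set.Ioi (1 : ℝ), a.1 < b.1 → a.1 - a.1⁻¹ < b.1 - b.1⁻¹ := by
        intro a b hab
        have ha : (0 : ℝ) < a.1 := zero_lt_one.trans a.2
        have := inv_strictAnti₀ ha hab
        linarith
      intro a b hab
      have hab' : a.1 - a.1⁻¹ = b.1 - b.1⁻¹ := congrArg Units.val hab
      rcases lt_trichotomy a.1 b.1 with h | h | h
      · exact absurd hab' (hlt a b h).ne
      · exact Subtype.ext h
      · exact absurd hab' (hlt b a h).ne'
    · rintro _ ⟨⟨q, hq : 1 < q⟩, rfl⟩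
      refine coeff_eq_zero_of_eval _ _ (Set.range fun N : ℕ =>
        Units.mk0 ((q ^ (N + 1))⁻¹ : ℝ) (by positivity)) ?_ ?_ k
      · refine Set.infinite_range_of_injective ?_
        intro a b hab
        have hab' : (q ^ (a + 1))⁻¹ = (q ^ (b + 1))⁻¹ := congrArg Units.val hab
        have := pow_right_injective₀ (zero_lt_one.trans hq) hq.ne' (inv_injective hab')
        omega
      · rintro _ ⟨N, rfl⟩
        have := h (N + 1) q hq (by omega)
        rw [← sub_eq_zero, ← map_sub] at this
        exact this
  rw [eq_intCast, Int.cast_eq_zero] at key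
  exact key

theorem sum_kap_ne_zero {q : ℝ} (hq : 1 < q) (hN : 1 ≤ N) : ∑ a, kap N q a ≠ 0 := by
  have : Nonempty (Fin N) := ⟨⟨0, hN⟩⟩
  refine (Finset.sum_pos (fun a _ => ?_) Finset.univ_nonempty).ne'
  exact zpow_pos (zero_lt_one.trans hq) _

/-- The normalized trace. -/
noncomputable def ntr {q : ℝ} (hq : 1 < q) (n : ℕ) (β : Braid n) : ℝ :=
  wtr N q n (rho N hq n β : Module.End ℝ (Sp N n)) / ∑ a, kap N q a

theorem ntr_skein {q : ℝ} (hq : 1 < q) {n : ℕ} (α β : Braid n) (i : Gen n) :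
    ntr N hq n (α * σ i * β) - ntr N hq n (α * (σ i)⁻¹ * β) =
      (q - q⁻¹) * ntr N hq n (α * β) := by
  rw [ntr, ntr, ntr, ← sub_div, wtr_skein, mul_div_assoc]

theorem ntr_one {q : ℝ} (hq : 1 < q) (hN : 1 ≤ N) : ntr N hq 1 1 = 1 := by
  have h := wtr_addStrand N hq (1 : Braid 0)
  rw [map_one] at h
  rw [ntr, h, mul_div_assoc, mul_comm, div_mul_cancel₀ _ (sum_kap_ne_zero N hq hN)]
  simp [wtr]

theorem exists_lift : ∀ (n : ℕ) (β : Braid (n + 1)), ∃ p : LaurentVZ,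
    ∀ (N : ℕ) (q : ℝ) (hq : 1 < q), 1 ≤ N → ev N hq p = ntr N hq (n + 1) β := by
  intro n
  induction n with
  | zero =>
    intro β
    refine ⟨1, fun N q hq hN => ?_⟩
    rw [map_one, Braid.one_of_le (by omega) β, ntr_one N hq hN]
  | succ n IH =>
    intro β
    induction cl_basic (n + 1) β with
    | base g hg =>
      rcases hg with ⟨a, rfl⟩ | ⟨_, a, b, rfl⟩
      · obtain ⟨p, hp⟩ := IH a
        refine ⟨LaurentPolynomial.C (LaurentPolynomial.T (-1)) * (vPow (-1) - vPow 1) * p,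
          fun N q hq hN => ?_⟩
        have hz : (q - q⁻¹) ≠ 0 := (sub_pos.mpr ((inv_lt_one_of_one_lt₀ hq).trans hq)).ne'
        have e : ev N hq (LaurentPolynomial.C (LaurentPolynomial.T (-1))) = (q - q⁻¹)⁻¹ := by
          rw [ev, LaurentPolynomial.eval₂_C, LaurentPolynomial.eval₂_T]; simp
        rw [map_mul, map_mul, map_sub, ev_vPow, ev_vPow_neg, hp N q hq hN, e, ntr, ntr,
          wtr_addStrand, ← sum_kap N hq, mul_comm _ (q - q⁻¹), inv_mul_cancel_left₀ hz,
          mul_div_assoc]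
      · obtain ⟨p, hp⟩ := IH (b * a)
        refine ⟨vPow (-1) * p, fun N q hq hN => ?_⟩
        rw [map_mul, ev_vPow_neg, hp N q hq hN, ntr, ntr,
          wtr_conj N hq (addStrand _ a * _), ← mul_assoc, ← map_mul, ← mul_div_assoc]
        exact congrArg (· / _) (wtr_pos N hq (b * a)).symm
    | pos x y i _ _ h1 h2 =>
      obtain ⟨p1, hp1⟩ := h1
      obtain ⟨p2, hp2⟩ := h2
      refine ⟨p1 + z * p2, fun N q hq hN => ?_⟩
      have := ntr_skein N hq x y i
      rw [map_add, map_mul, ev_z, hp1 N q hq hN, hp2 N q hq hN]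
      linarith
    | neg x y i _ _ h1 h2 =>
      obtain ⟨p1, hp1⟩ := h1
      obtain ⟨p2, hp2⟩ := h2
      refine ⟨p1 - z * p2, fun N q hq hN => ?_⟩
      have := ntr_skein N hq x y i
      rw [map_sub, map_mul, ev_z, hp1 N q hq hN, hp2 N q hq hN]
      linarith

end Existence

/-- The defining relations have exactly one solution. -/
theorem existsUnique_framedHomfly :
    ∃! H : (n : ℕ) → Braid n → LaurentVZ, IsFramedHomfly H := by
  choose P hP using exists_lift
  refine ⟨fun n => match n with
    | 0 => fun _ => 0
    | n + 1 => P n, ?_, fun H' h' => h'.unique ?_⟩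
  rotate_right
  all_goals
    refine ⟨?_, ?_, ?_, ?_, ?_, fun _ => rfl⟩
    · intro n α β
      cases n with
      | zero => rfl
      | succ n =>
        refine eq_of_ev fun N q hq hN => ?_
        rw [hP _ _ N q hq hN, hP _ _ N q hq hN, ntr, ntr, wtr_conj]
    · intro n α β i
      cases n with
      | zero => simp
      | succ n =>
        refine eq_of_ev fun N q hq hN => ?_
        rw [map_sub, map_mul, hP _ _ N q hq hN, hP _ _ N q hq hN, hP _ _ N q hq hN, ev_z,
          ntr_skein]
    · intro n α
      refine eq_of_ev fun N q hq hN => ?_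
      rw [map_mul, hP _ _ N q hq hN, hP _ _ N q hq hN, ev_vPow_neg, ntr, ntr, ← mul_div_assoc,
        wtr_pos]
    · intro n α
      refine eq_of_ev fun N q hq hN => ?_
      rw [map_mul, hP _ _ N q hq hN, hP _ _ N q hq hN, ev_vPow, ntr, ntr, ← mul_div_assoc,
        wtr_neg]
    · refine eq_of_ev fun N q hq hN => ?_
      rw [hP _ _ N q hq hN, map_one, ntr_one N hq hN]

/-- The framed Homfly polynomial of the closure of a braid: the unique solution of the
defining relations. -/
noncomputable def framedHomfly {n : ℕ} (β : Braid n) : LaurentVZ :=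
  existsUnique_framedHomfly.choose n β

theorem isFramedHomfly : IsFramedHomfly (fun n (β : Braid n) => framedHomfly β) :=
  existsUnique_framedHomfly.choose_spec.1

/-- The Homfly polynomial of the closure of a braid: the framed polynomial multiplied
by `v` to the power of the writhe. -/
noncomputable def homfly {n : ℕ} (β : Braid n) : LaurentVZ :=
  vPow (expSum β) * framedHomfly β

/-! ### Columns and the Morton–Franks–Williams bounds -/

/-- The column of `P` at `v ^ k`: the coefficient of `v ^ k`, a Laurent polynomial in `z`. -/
noncomputable def column (P : LaurentVZ) (k : ℤ) : ℤ[T;T⁻¹] := P.coeff k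

/-- The powers of `v` that occur in `P`. -/
noncomputable def vDegrees (P : LaurentVZ) : Set ℤ := {k | column P k ≠ 0}

/-- The left column of `P`: the coefficient of the lowest power of `v` that occurs in `P`
(zero for `P = 0`). -/
noncomputable def leftColumn (P : LaurentVZ) : ℤ[T;T⁻¹] := column P (sInf (vDegrees P))

/-- The right column of `P`: the coefficient of the highest power of `v` that occurs in `P`
(zero for `P = 0`). -/
noncomputable def rightColumn (P : LaurentVZ) : ℤ[T;T⁻¹] := column P (sSup (vDegrees P))

/-- The lower bound `w - n + 1 ≤ lowest v-degree` is an equality for the closure of `β`. -/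
def LowerMFWSharp {n : ℕ} (β : Braid n) : Prop :=
  IsLeast (vDegrees (homfly β)) (expSum β - n + 1)

/-- The upper bound `highest v-degree ≤ w + n - 1` is an equality for the closure of `β`. -/
def UpperMFWSharp {n : ℕ} (β : Braid n) : Prop :=
  IsGreatest (vDegrees (homfly β)) (expSum β + n - 1)

end Homfly

/-! Multiplication by a power of `v` only shifts columns, and the framed polynomial of a braid on `n
+ 1` strands has its columns between `-n` and `n` (`column_eq_zero`). Hence an estimate is sharp
exactly when the extreme framed column, at `n` or `-n`, is nonzero, and the writhe of `β * Δ (n + 1)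
^ (-2)` never has to be computed. The theorem reduces to `column_mul_Δ`: up to the sign `(-1) ^ n`,
the negative full twist carries the top framed column to the bottom one.

Both sides of that identity satisfy the Conway relation as functions of `β`, since right
multiplication by a fixed braid preserves it. By `cl_basic` it is therefore enough to compare them
on braids that contain the last generator at most once, and positively. The comparison is by
induction on the number of strands, using that the full twist is the full twist of the other strands
times a loop of the last strand around them, and that this loop commutes with the other strands
(`Δ_succ_sq`, `lastLoop_commute`).

If the last generator occurs once, the closure has a positive curl, and the negative loop turns it
into a negative curl. Removing the curl moves the column in question beyond the bounds for one
strand fewer, so both sides vanish. If the last generator does not occur, the negative loop can be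
undone (`IsSkein.lastLoop_inv`): every correction term in the skein computation has a negative curl,
hence a zero column at the bottom. For a split strand, `z` times a column is the difference of the
two neighbouring columns of the smaller braid (`column_addStrand`). At the top only the subtracted
column survives, at the bottom only the other one; this is the source of the sign. -/

namespace Homfly

/-! ### The full twist -/

/-- The braid `σ₁ σ₂ ⋯ σₙ` on `n + 1` strands. -/
def ascending (n : ℕ) : Braid (n + 1) :=
  (List.ofFn fun i : Fin n => σ ⟨i.1, Nat.succ_lt_succ i.2⟩).prod

/-- The braid `σₙ ⋯ σ₂ σ₁` on `n + 1` strands. -/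
def descending : (n : ℕ) → Braid (n + 1)
  | 0 => 1
  | n + 1 => σ (lastGen n) * addStrand (n + 1) (descending n)

/-- The braid `σₙ ⋯ σ₁ σ₁ ⋯ σₙ` in which the last strand goes once around the others. -/
def lastLoop : (n : ℕ) → Braid (n + 1)
  | 0 => 1
  | n + 1 => σ (lastGen n) * addStrand (n + 1) (lastLoop n) * σ (lastGen n)

theorem ascending_succ (n : ℕ) :
    ascending (n + 1) = addStrand (n + 1) (ascending n) * σ (lastGen n) := by
  rw [ascending, List.ofFn_succ', List.prod_concat, ascending, map_list_prod, List.map_ofFn]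
  congr 3

theorem Δ_succ (n : ℕ) : Δ (n + 1) = ascending n * addStrand n (Δ n) := rfl

/-- The mirror decomposition of the half twist: the last generator slides past a braid that avoids
the last two strands. Combined with `Δ_succ`, it brings the descending and the ascending factor
together in the middle of the square. -/
theorem Δ_succ' (n : ℕ) : Δ (n + 1) = addStrand n (Δ n) * descending n := by
  induction n with
  | zero => simp [descending, Δ]
  | succ n ih =>
    calc Δ (n + 2) = addStrand (n + 1) (ascending n) * (σ (lastGen n) *
          addStrand (n + 1) (addStrand n (Δ n))) * addStrand (n + 1) (descending n) := by
          rw [Δ_succ, ascending_succ, ih, map_mul]; simp only [mul_assoc]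
      _ = addStrand (n + 1) (ascending n * addStrand n (Δ n)) * descending (n + 1) := by
          rw [last_comm, descending, map_mul]; simp only [mul_assoc]

theorem lastLoop_eq (n : ℕ) : lastLoop n = descending n * ascending n := by
  induction n with
  | zero => simp [lastLoop, descending, ascending]
  | succ n ih => rw [lastLoop, ih, ascending_succ, descending, map_mul]; simp only [mul_assoc]

/-- Geometrically, the last strand encircles all the others as one cable, so a braid in the cable
can slide through the loop. -/
theorem lastLoop_commute (n : ℕ) (a : Braid n) : Commute (lastLoop n) (addStrand n a) := by
  induction n with
  | zero => rw [Braid.one_of_le (by omega) a, map_one]; exact Commute.one_right _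
  | succ n ih =>
    have gen : ∀ i : Gen (n + 1), Commute (lastLoop (n + 1)) (addStrand (n + 1) (σ i)) := by
      intro i
      -- A generator away from the last one commutes with each of the three factors of the loop. The
      -- generator next to the last one needs the braid relation, once on each side of the inner
      -- loop.
      by_cases hi : i.1 + 1 < n
      · have e : σ i = addStrand n (σ ⟨i.1, hi⟩) := (addStrand_σ (n := n) ⟨i.1, hi⟩).symm
        have h1 : Commute (σ (lastGen n)) (addStrand (n + 1) (σ i)) := by
          rw [e]; exact last_comm _
        have h2 : Commute (addStrand (n + 1) (lastLoop n)) (addStrand (n + 1) (σ i)) := by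
          rw [e]; exact (ih _).map _
        exact (h1.mul_left h2).mul_left h1
      · obtain ⟨m, rfl⟩ : ∃ m, n = m + 1 := ⟨n - 1, by have := i.2; omega⟩
        obtain rfl : i = lastGen m := Subtype.ext (by have := i.2; simp only [lastGen]; omega)
        have hb := σ_braid (⟨m, by omega⟩ : Gen (m + 1 + 2)) (lastGen (m + 1)) rfl
        have hc := last_comm (lastLoop m)
        rw [addStrand_σ, lastLoop, lastLoop, map_mul, map_mul, addStrand_σ]
        simp only [lastGen] at hb hc ⊢
        generalize addStrand (m + 1 + 1) (addStrand (m + 1) (lastLoop m)) = X at hc ⊢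
        generalize (σ ⟨m + 1, _⟩ : Braid (m + 1 + 2)) = s at hb hc ⊢
        generalize (σ ⟨m, _⟩ : Braid (m + 1 + 2)) = t at hb ⊢
        calc s * (t * X * t) * s * t = s * t * X * (t * s * t) := by simp only [mul_assoc]
          _ = s * t * (X * s) * t * s := by rw [hb]; simp only [mul_assoc]
          _ = (s * t * s) * X * t * s := by rw [← hc]; simp only [mul_assoc]
          _ = t * (s * (t * X * t) * s) := by rw [← hb]; simp only [mul_assoc]
    induction a using Braid.ind with
    | one => rw [map_one]; exact Commute.one_right _
    | pos i g h => rw [map_mul]; exact (gen i).mul_right h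
    | neg i g h => rw [map_mul, map_inv]; exact (gen i).inv_right.mul_right h

theorem Δ_succ_sq (n : ℕ) : Δ (n + 1) ^ 2 = addStrand n (Δ n ^ 2) * lastLoop n := by
  calc Δ (n + 1) ^ 2 = addStrand n (Δ n) * descending n * (ascending n * addStrand n (Δ n)) := by
        rw [pow_two]; nth_rewrite 1 [Δ_succ']; rw [Δ_succ]
    _ = addStrand n (Δ n) * (lastLoop n * addStrand n (Δ n)) := by
        rw [lastLoop_eq]; simp only [mul_assoc]
    _ = _ := by rw [lastLoop_commute n, pow_two, map_mul, mul_assoc]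

theorem Δ_succ_zpow (n : ℕ) :
    Δ (n + 1) ^ (-2 : ℤ) = (lastLoop n)⁻¹ * addStrand n (Δ n ^ (-2 : ℤ)) := by
  simp only [zpow_neg, zpow_ofNat, map_inv]
  rw [Δ_succ_sq, mul_inv_rev]

/-! ### Skein functionals -/

/-- Functions on the braid group that satisfy the Conway skein relation. -/
def IsSkein {n : ℕ} (f : Braid n → ℤ[T;T⁻¹]) : Prop :=
  ∀ (x y : Braid n) (i : Gen n),
    f (x * σ i * y) - f (x * (σ i)⁻¹ * y) = LaurentPolynomial.T 1 * f (x * y)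

theorem IsSkein.comp_mul {n : ℕ} {f : Braid n → ℤ[T;T⁻¹]} (hf : IsSkein f) (a b : Braid n) :
    IsSkein fun x => f (a * x * b) := fun x y i => by
  simpa only [mul_assoc] using hf (a * x) (y * b) i

theorem IsSkein.comp_addStrand {n : ℕ} {f : Braid (n + 1) → ℤ[T;T⁻¹]} (hf : IsSkein f) :
    IsSkein fun x => f (addStrand n x) := fun x y i => by
  simpa only [map_mul, map_inv, addStrand_σ] using
    hf (addStrand n x) (addStrand n y) ⟨i.1, Nat.lt_succ_of_lt i.2⟩

/-- In a Conway triple the values at two of the braids determine the third, so agreement spreads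
along `SkeinSpan`, which by `cl_basic` reaches every braid. -/
theorem IsSkein.eq_of_eqOn_basic {n : ℕ} {f g : Braid (n + 1) → ℤ[T;T⁻¹]} (hf : IsSkein f)
    (hg : IsSkein g) (h : ∀ x ∈ Basic n, f x = g x) (x : Braid (n + 1)) : f x = g x := by
  induction cl_basic n x with
  | base x hx => exact h x hx
  | pos x y i _ _ h1 h2 =>
    rw [sub_eq_iff_eq_add.mp (hf x y i), sub_eq_iff_eq_add.mp (hg x y i), h1, h2]
  | neg x y i _ _ h1 h2 =>
    have e := hf x y i
    rw [h1, h2, ← hg x y i] at e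
    exact sub_right_injective e

/-- A skein functional that vanishes on the braids with a single negative crossing of the last
strand does not see a negative loop of the last strand. -/
theorem IsSkein.lastLoop_inv : ∀ {n : ℕ} {f : Braid (n + 1) → ℤ[T;T⁻¹]}, IsSkein f →
    (∀ (m : ℕ) (h : n = m + 1) (a b : Braid n),
      f (addStrand n a * (σ ⟨m, by omega⟩)⁻¹ * addStrand n b) = 0) →
    f (lastLoop n)⁻¹ = f 1 := by
  intro n
  induction n with
  | zero => intro f _ _; simp [lastLoop]
  | succ n ih =>
    intro f hf h0
    -- With `s` the last generator, the loop is `s` times the smaller loop times `s`. The induction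
    -- hypothesis is applied to `x ↦ f (s⁻¹ * x * s⁻¹)`, and leaves `f (s⁻¹ * s⁻¹)` to be computed.
    have h1 := ih (hf.comp_mul (σ (lastGen n))⁻¹ (σ (lastGen n))⁻¹).comp_addStrand ?_
    -- Switching the second crossing of `s⁻¹ * s⁻¹` gives the trivial braid; the smoothing is `s⁻¹`,
    -- on which `f` vanishes.
    · have h2 := hf (σ (lastGen n))⁻¹ 1 (lastGen n)
      have h3 := h0 n rfl 1 1
      simp only [map_one, mul_one, one_mul] at h1 h2 h3
      rw [inv_mul_cancel, show f (σ (lastGen n))⁻¹ = 0 from h3, mul_zero, sub_eq_zero] at h2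
      rw [lastLoop, mul_inv_rev, mul_inv_rev, ← mul_assoc, h2, ← h1, map_inv]
    · rintro m rfl a b
      -- The new functional inherits the vanishing: with `t` the generator before `s`, the braid
      -- relation rewrites `s⁻¹ * t⁻¹ * s⁻¹` as `t⁻¹ * s⁻¹ * t⁻¹`, which contains `s⁻¹` only once.
      have hb := σ_braid (⟨m, by omega⟩ : Gen (m + 1 + 2)) (lastGen (m + 1)) rfl
      have ha := (show Commute _ _ from last_comm a).inv_left
      have hc := (show Commute _ _ from last_comm b).inv_left
      have h4 := h0 (m + 1) rfl (addStrand (m + 1) a * (σ ⟨m, by omega⟩)⁻¹)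
        ((σ ⟨m, by omega⟩)⁻¹ * addStrand (m + 1) b)
      rw [← h4]
      congr 1
      simp only [map_mul, map_inv, addStrand_σ]
      simp only [lastGen] at ha hb hc ⊢
      generalize addStrand (m + 1 + 1) (addStrand (m + 1) a) = X at ha ⊢
      generalize addStrand (m + 1 + 1) (addStrand (m + 1) b) = Y at hc ⊢
      generalize (σ ⟨m + 1, _⟩ : Braid (m + 1 + 2)) = s at hb ha hc ⊢
      generalize (σ ⟨m, _⟩ : Braid (m + 1 + 2)) = t at hb ⊢
      have hb' : t⁻¹ * s⁻¹ * t⁻¹ = s⁻¹ * t⁻¹ * s⁻¹ := by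
        simpa only [mul_inv_rev, mul_assoc] using congrArg (·⁻¹) hb
      calc s⁻¹ * (X * t⁻¹ * Y) * s⁻¹ = (s⁻¹ * X) * t⁻¹ * (Y * s⁻¹) := by simp only [mul_assoc]
        _ = X * (s⁻¹ * t⁻¹ * s⁻¹) * Y := by rw [ha.eq, ← hc.eq]; simp only [mul_assoc]
        _ = X * t⁻¹ * s⁻¹ * (t⁻¹ * Y) := by rw [← hb']; simp only [mul_assoc]

/-! ### Columns of the framed Homfly polynomial -/

theorem column_vPow_mul (k : ℤ) (P : LaurentVZ) (j : ℤ) :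
    column (vPow k * P) j = column P (j - k) := by
  rw [column, column, vPow, LaurentPolynomial.T]
  rw [AddMonoidAlgebra.coeff_single_mul_eq_mul_coeff (j - k)
    (fun m _ => ⟨fun h => by omega, fun h => by omega⟩), one_mul]

theorem column_z_mul (P : LaurentVZ) (j : ℤ) :
    column (z * P) j = LaurentPolynomial.T 1 * column P j := by
  rw [column, column, z, LaurentPolynomial.C]
  exact AddMonoidAlgebra.coeff_single_mul_eq_mul_coeff j
    (fun m _ => ⟨fun h => by omega, fun h => by omega⟩)

theorem column_sub (P Q : LaurentVZ) (j : ℤ) : column (P - Q) j = column P j - column Q j := rfl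

theorem isSkein_column (n : ℕ) (k : ℤ) :
    IsSkein fun β : Braid n => column (framedHomfly β) k := fun x y i => by
  rw [← column_sub, isFramedHomfly.skein, column_z_mul]

theorem column_curl_pos {n : ℕ} (a b : Braid (n + 1)) (k : ℤ) :
    column (framedHomfly (addStrand (n + 1) a * σ (lastGen n) * addStrand (n + 1) b)) k =
      column (framedHomfly (b * a)) (k + 1) := by
  rw [isFramedHomfly.conj, ← mul_assoc, ← map_mul, isFramedHomfly.curl_pos, column_vPow_mul,
    sub_neg_eq_add]

theorem column_curl_neg {n : ℕ} (a b : Braid (n + 1)) (k : ℤ) :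
    column (framedHomfly (addStrand (n + 1) a * (σ (lastGen n))⁻¹ * addStrand (n + 1) b)) k =
      column (framedHomfly (b * a)) (k - 1) := by
  rw [isFramedHomfly.conj, ← mul_assoc, ← map_mul, isFramedHomfly.curl_neg, column_vPow_mul]

/-- Joining the split strand to its neighbour by a positive or a negative crossing gives the two
curls of a Conway triple whose smoothing is the split diagram. -/
theorem column_addStrand {n : ℕ} (a : Braid (n + 1)) (k : ℤ) :
    LaurentPolynomial.T 1 * column (framedHomfly (addStrand (n + 1) a)) k =
      column (framedHomfly a) (k + 1) - column (framedHomfly a) (k - 1) := by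
  have h := isSkein_column (n + 2) k (addStrand (n + 1) a) (addStrand (n + 1) 1) (lastGen n)
  simp only [column_curl_pos, column_curl_neg] at h
  simpa only [one_mul, map_one, mul_one] using h.symm

theorem T_mul_cancel {a b : ℤ[T;T⁻¹]}
    (h : LaurentPolynomial.T 1 * a = LaurentPolynomial.T 1 * b) : a = b :=
  (LaurentPolynomial.isUnit_T 1).mul_left_cancel h

/-- The Morton–Franks–Williams bounds, for the framed polynomial. -/
theorem column_eq_zero {n : ℕ} (β : Braid (n + 1)) {k : ℤ} (hk : n < |k|) :
    column (framedHomfly β) k = 0 := by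
  induction n generalizing k with
  | zero =>
    rw [Braid.one_of_le (by omega) β, isFramedHomfly.unknot]
    have h0 : k ≠ 0 := by rintro rfl; simp at hk
    rw [column, AddMonoidAlgebra.one_def]
    exact Finsupp.single_eq_of_ne h0
  | succ n ih =>
    have h1 : (n : ℤ) < |k + 1| := by push_cast at hk; grind
    have h2 : (n : ℤ) < |k - 1| := by push_cast at hk; grind
    -- The zero function is a skein functional as well, so vanishing only has to be checked on the
    -- basic braids. There the column is governed by columns `k + 1` and `k - 1` on one strand
    -- fewer, and both are still out of range.
    refine (isSkein_column _ k).eq_of_eqOn_basic (g := fun _ => 0) (fun _ _ _ => by simp) ?_ β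
    rintro x (⟨a, rfl⟩ | ⟨h, a, b, rfl⟩)
    · refine T_mul_cancel ?_
      rw [column_addStrand, ih a h1, ih a h2, sub_self, mul_zero]
    · exact (column_curl_pos a b k).trans (ih _ h1)

/-- The extreme columns are exchanged by a negative full twist. -/
theorem column_mul_Δ {n : ℕ} (β : Braid (n + 1)) :
    column (framedHomfly β) n =
      (-1) ^ n * column (framedHomfly (β * Δ (n + 1) ^ (-2 : ℤ))) (-n) := by
  induction n with
  | zero => rw [Braid.one_of_le (by omega) (β * _), Braid.one_of_le (by omega) β]; simp
  | succ n ih =>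
    -- Removing a positive curl moves column `n + 1` to `n + 2`, and removing a negative one moves
    -- `-(n + 1)` to `-(n + 2)`. Both lie beyond the bound `n` for `n + 1` strands.
    have hn : ∀ γ : Braid (n + 1), column (framedHomfly γ) ((n + 1 : ℕ) + 1 : ℤ) = 0 := fun γ =>
      column_eq_zero γ (by push_cast; grind)
    have hn' : ∀ γ : Braid (n + 1), column (framedHomfly γ) (-(n + 1 : ℕ) - 1 : ℤ) = 0 := fun γ =>
      column_eq_zero γ (by push_cast; grind)
    have hskein : IsSkein fun β : Braid (n + 2) =>
        (-1) ^ (n + 1) * column (framedHomfly (β * Δ (n + 2) ^ (-2 : ℤ))) (-(n + 1 : ℕ)) := by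
      intro x y i
      have := isSkein_column _ (-(n + 1 : ℕ)) x (y * Δ (n + 2) ^ (-2 : ℤ)) i
      simp only [← mul_assoc] at this
      rw [← mul_sub, this, mul_left_comm]
    refine (isSkein_column _ _).eq_of_eqOn_basic hskein ?_ β
    rintro x (⟨a, rfl⟩ | ⟨h, a, b, rfl⟩)
    · refine T_mul_cancel ?_
      -- The negative loop of the split strand is undone: a single negative crossing of that strand
      -- would be a negative curl, which does not contribute to column `-(n + 1)`.
      have hloop : column (framedHomfly (addStrand (n + 1) a * Δ (n + 2) ^ (-2 : ℤ)))
          (-(n + 1 : ℕ)) =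
          column (framedHomfly (addStrand (n + 1) (a * Δ (n + 1) ^ (-2 : ℤ)))) (-(n + 1 : ℕ)) := by
        have := ((isSkein_column (n + 2) (-(n + 1 : ℕ))).comp_mul (addStrand (n + 1) a)
          (addStrand (n + 1) (Δ (n + 1) ^ (-2 : ℤ)))).lastLoop_inv ?_
        · rw [Δ_succ_zpow, ← mul_assoc, this, mul_one, map_mul]
        · rintro m h' c d
          obtain rfl : n = m := by omega
          have e := column_curl_neg (a * c) (d * Δ (n + 1) ^ (-2 : ℤ)) (-(n + 1 : ℕ))
          rw [hn'] at e
          simpa only [map_mul, mul_assoc, lastGen] using e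
      -- One of the two neighbouring columns is out of range on each side. What remains is minus
      -- column `n` of `a` against column `-n` of its twisted version, so the induction hypothesis
      -- applies with one extra sign.
      rw [column_addStrand, hn, mul_left_comm, hloop, column_addStrand, hn', zero_sub, sub_zero]
      have e1 : ((n + 1 : ℕ) : ℤ) - 1 = n := by push_cast; ring
      have e2 : -((n + 1 : ℕ) : ℤ) + 1 = -n := by push_cast; ring
      rw [e1, e2, ih, pow_succ]
      ring
    -- Once the loop has been moved next to it, the positive crossing cancels one of the two outer
    -- negative crossings of the inverse loop. A single negative crossing of the last strand is
    -- left, that is, a negative curl.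
    · have e : addStrand (n + 1) a * σ (lastGen n) * addStrand (n + 1) b *
          Δ (n + 2) ^ (-2 : ℤ) = addStrand (n + 1) (a * (lastLoop n)⁻¹) * (σ (lastGen n))⁻¹ *
            addStrand (n + 1) (b * Δ (n + 1) ^ (-2 : ℤ)) := by
        rw [Δ_succ_zpow]
        have hc := (lastLoop_commute (n + 1) b).inv_left.eq
        calc _ = addStrand (n + 1) a * σ (lastGen n) *
              (addStrand (n + 1) b * (lastLoop (n + 1))⁻¹) *
              addStrand (n + 1) (Δ (n + 1) ^ (-2 : ℤ)) := by simp only [mul_assoc]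
          _ = _ := by
            rw [← hc, lastLoop]
            simp only [map_mul, map_inv, mul_inv_rev, mul_assoc, mul_inv_cancel_left]
      refine (column_curl_pos a b _).trans ?_
      rw [hn]
      change (0 : ℤ[T;T⁻¹]) = (-1) ^ (n + 1) * column (framedHomfly (addStrand (n + 1) a *
        σ (lastGen n) * addStrand (n + 1) b * Δ (n + 2) ^ (-2 : ℤ))) (-(n + 1 : ℕ))
      rw [e, column_curl_neg, hn', mul_zero]

/-! ### Sharpness in terms of the extreme framed columns -/

theorem column_homfly {n : ℕ} (β : Braid n) (k : ℤ) :
    column (homfly β) k = column (framedHomfly β) (k - expSum β) :=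
  column_vPow_mul _ _ _

/-- The upper estimate itself always holds by `column_eq_zero`, so only membership of the extreme
degree is at stake; the writhe cancels. -/
theorem upperMFWSharp_iff {n : ℕ} (β : Braid (n + 1)) :
    UpperMFWSharp β ↔ column (framedHomfly β) n ≠ 0 := by
  have e : expSum β + (n + 1 : ℕ) - 1 - expSum β = n := by push_cast; ring
  rw [UpperMFWSharp, IsGreatest, vDegrees, Set.mem_ofPred_eq, column_homfly, e]
  refine and_iff_left fun k hk => ?_
  by_contra hlt
  refine hk ((column_homfly β k).trans (column_eq_zero β ?_))
  push_cast at hlt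
  exact lt_of_lt_of_le (by linarith) (le_abs_self _)

theorem lowerMFWSharp_iff {n : ℕ} (β : Braid (n + 1)) :
    LowerMFWSharp β ↔ column (framedHomfly β) (-n) ≠ 0 := by
  have e : expSum β - (n + 1 : ℕ) + 1 - expSum β = -n := by push_cast; ring
  rw [LowerMFWSharp, IsLeast, vDegrees, Set.mem_ofPred_eq, column_homfly, e]
  refine and_iff_left fun k hk => ?_
  by_contra hlt
  refine hk ((column_homfly β k).trans (column_eq_zero β ?_))
  push_cast at hlt
  exact lt_of_lt_of_le (by linarith) (neg_le_abs _)

/-- Sharpness locates the supremum that defines `rightColumn`: it is the extreme degree, which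
corresponds to framed column `n`. -/
theorem UpperMFWSharp.rightColumn_eq {n : ℕ} {β : Braid (n + 1)} (h : UpperMFWSharp β) :
    rightColumn (homfly β) = column (framedHomfly β) n := by
  rw [rightColumn, IsGreatest.csSup_eq h, column_homfly]
  congr 1; push_cast; ring

theorem LowerMFWSharp.leftColumn_eq {n : ℕ} {β : Braid (n + 1)} (h : LowerMFWSharp β) :
    leftColumn (homfly β) = column (framedHomfly β) (-n) := by
  rw [leftColumn, IsLeast.csInf_eq h, column_homfly]
  congr 1; push_cast; ring

end Homfly

theorem mainTheorem5 (n : ℕ) (hn : 1 ≤ n) (β : Homfly.Braid n) :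
    (Homfly.UpperMFWSharp β ↔ Homfly.LowerMFWSharp (β * Homfly.Δ n ^ (-2 : ℤ))) ∧
    (Homfly.UpperMFWSharp β →
      Homfly.rightColumn (Homfly.homfly β) =
        (-1) ^ (n - 1) * Homfly.leftColumn (Homfly.homfly (β * Homfly.Δ n ^ (-2 : ℤ)))) := by
  obtain ⟨n, rfl⟩ : ∃ m, n = m + 1 := ⟨n - 1, by omega⟩
  have hiff : Homfly.UpperMFWSharp β ↔
      Homfly.LowerMFWSharp (β * Homfly.Δ (n + 1) ^ (-2 : ℤ)) := by
    rw [Homfly.upperMFWSharp_iff, Homfly.lowerMFWSharp_iff, Homfly.column_mul_Δ, not_iff_not]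
    -- The sign is a unit, so it does not affect whether the column vanishes.
    exact (isUnit_one.neg.pow n).mul_right_eq_zero
  refine ⟨hiff, fun h => ?_⟩
  rw [h.rightColumn_eq, (hiff.mp h).leftColumn_eq, Homfly.column_mul_Δ, Nat.add_sub_cancel]
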